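/- Let $n\ge 0$ and let $m=(m_1,\dots,m_n)$ be integers with $m_i>1$ for every $i$. Let $Q(\underline{x},y)=y^r+\sum_{i=0}^{r-1}a_i(\underline{x})\,y^i\in\mathbb{C}[x_1,\dots,x_n][y]$ be monic in $y$ of degree $r\ge 2$, and let $$B=\mathbb{C}[x_1,\dots,x_n,y,z]\big/\big(x_1^{m_1}\cdots x_n^{m_n}\,z-Q(\underline{x},y)\big)$$ be the coordinate ring of the hypersurface $X_{[m],Q}=\operatorname{Spec}B\subset\mathbb{C}^{n+2}$ with equation $x_1^{m_1}\cdots x_n^{m_n}\,z=Q(\underline{x},y)$. The Makar-Limanov invariant $\mathrm{ML}(X_{[m],Q})\subset B$ is the subalgebra of all $b\in B$ that are invariant under every algebraic action of the additive group $\mathbb{C}_+$ on $X_{[m],Q}$; such an action is given by a $\mathbb{C}$-algebra homomorphism $\mu:B\to B[t]$ (its comorphism) satisfying the identity and additivity axioms of an action, and $b$ is invariant under it if $\mu(b)=b$. Then the canonical map $\mathbb{C}[x_1,\dots,x_n]\to B$ is injective and its image is exactly $\mathrm{ML}(X_{[m],Q})$; thus $\mathrm{ML}(X_{[m],Q})=\mathbb{C}[x_1,\dots,x_n]$.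 Moreover, for every nonzero locally nilpotent $\mathbb{C}$-derivation $\partial$ of $B$ (every $b\in B$ satisfies $\partial^N b=0$ for some $N$ depending on $b$), the kernel $\operatorname{Ker}(\partial^2)$ is contained in the image of $\mathbb{C}[x_1,\dots,x_n,y]$ in $B$. -/

import Mathlib

open Polynomial

noncomputable section

namespace Danielewski

/-- An algebraic action of the additive group `(k, +)` on the affine scheme `Spec B`, given by
its comorphism `μ : B → B ⊗ k[t] = B[t]`. The axiom `zero_act` says that `0` acts as the identity.
The axiom `add_act` says that acting twice is acting by the sum of the parameters: with
`μ b = ∑ bⱼ tʲ`, it is the identity `∑ μ(bⱼ)(s) tʲ = ∑ bⱼ (t + s)ʲ` in `B[s][t]`. -/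
structure AdditiveAction (k B : Type*) [CommRing k] [CommRing B] [Algebra k B] where
  comorphism : B →ₐ[k] B[X]
  zero_act : ∀ b : B, (comorphism b).eval 0 = b
  add_act : ∀ b : B,
    (comorphism b).map (comorphism : B →+* B[X]) = aeval (X + C X : B[X][X]) (comorphism b)

/-- A function `b` on `Spec B` is invariant under an action if its comorphism sends `b` to the
constant polynomial `b`. -/
def AdditiveAction.IsInvariant {k B : Type*} [CommRing k] [CommRing B] [Algebra k B]
    (μ : AdditiveAction k B) (b : B) : Prop :=
  μ.comorphism b = C b

/-- The Makar-Limanov invariant of `Spec B`: the subalgebra of all `b : B` that are invariant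
under every action of the additive group on `Spec B`. -/
def makarLimanov (k B : Type*) [CommRing k] [CommRing B] [Algebra k B] : Subalgebra k B where
  carrier := {b | ∀ μ : AdditiveAction k B, μ.IsInvariant b}
  mul_mem' := fun {a b} ha hb μ => by
    have h1 : μ.comorphism a = C a := ha μ
    have h2 : μ.comorphism b = C b := hb μ
    show μ.comorphism (a * b) = C (a * b)
    rw [map_mul, h1, h2, C_mul]
  add_mem' := fun {a b} ha hb μ => by
    have h1 : μ.comorphism a = C a := ha μ
    have h2 : μ.comorphism b = C b := hb μ
    show μ.comorphism (a + b) = C (a + b)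
    rw [map_add, h1, h2, C_add]
  algebraMap_mem' := fun c μ => by
    show μ.comorphism (algebraMap k B c) = C (algebraMap k B c)
    rw [AlgHom.commutes]
    rfl

/-- A derivation is locally nilpotent if each element is killed by some power of it. -/
def IsLocallyNilpotent {k B : Type*} [CommRing k] [CommRing B] [Algebra k B]
    (D : Derivation k B B) : Prop :=
  ∀ b : B, ∃ N : ℕ, D^[N] b = 0

/-- The monomial `x₁^(m₁) ⋯ xₙ^(mₙ)` in `ℂ[x₁, …, xₙ]`. -/
def xMonomial {n : ℕ} (m : Fin n → ℕ) : MvPolynomial (Fin n) ℂ :=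
  ∏ i, MvPolynomial.X i ^ m i

/-- The equation `x^[m] z - Q(x, y)`, an element of `ℂ[x₁, …, xₙ][y][z]` (the inner polynomial
variable is `y`, the outer one is `z`). -/
def equation {n : ℕ} (m : Fin n → ℕ) (Q : (MvPolynomial (Fin n) ℂ)[X]) :
    (MvPolynomial (Fin n) ℂ)[X][X] :=
  C (C (xMonomial m)) * X - C Q

/-- The coordinate ring `ℂ[x₁, …, xₙ, y, z] / (x^[m] z - Q(x, y))` of the hypersurface
`X_{[m],Q}`; `AdjoinRoot f` is the quotient of a polynomial ring by the ideal generated by `f`,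
and the adjoined root is the class of `z`. -/
abbrev CoordRing {n : ℕ} (m : Fin n → ℕ) (Q : (MvPolynomial (Fin n) ℂ)[X]) : Type :=
  AdjoinRoot (equation m Q)

/-- The canonical map from `ℂ[x₁, …, xₙ, y]` to the coordinate ring. -/
def fromXY {n : ℕ} (m : Fin n → ℕ) (Q : (MvPolynomial (Fin n) ℂ)[X]) :
    (MvPolynomial (Fin n) ℂ)[X] →ₐ[ℂ] CoordRing m Q :=
  AdjoinRoot.ofAlgHom ℂ (equation m Q)

/-- The canonical map from `ℂ[x₁, …, xₙ]` to the coordinate ring. -/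
def fromX {n : ℕ} (m : Fin n → ℕ) (Q : (MvPolynomial (Fin n) ℂ)[X]) :
    MvPolynomial (Fin n) ℂ →ₐ[ℂ] CoordRing m Q :=
  (fromXY m Q).comp CAlgHom

end Danielewski

end

open Polynomial

noncomputable section

namespace Danielewski

/-! ### Exponents -/

/-! Inverting the `x_k` turns `z` into `x^(-m) Q`, so the coordinate ring B embeds in the Laurent
polynomials in `y, x_1, …, x_n` (`toLaurent_injective`). Order exponents lexicographically with `y`
first. Since `Q` is monic in `y`, the leading exponent of `z` is `(r, -m)`. Dividing by `Q` writes
each element as a polynomial in `z` with coefficients of `y`-degree below `r`; no leading terms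
cancel, so all leading exponents satisfy `IsExponent` (`exists_hasTop_or_eq_zero`).

A nonzero derivation D acts by `χ^v ↦ χ^v Λ(v)` with Λ additive. Its leading part has a degree `E`
and a linear form `l`: a leading term `c χ^u` goes to `c l(u) χ^(u+E)` (`exists_leading_part`). If D
is locally nilpotent, every leading exponent `u` has some N with `l(u + N E) = 0`, and the points `u
+ j E`, `j ≤ N`, of its string are again leading exponents (`exists_order`). For the generators this
gives integer identities and memberships which force `E` to have negative `y`-component
(`degree_neg_of_orders`); only here is `m_k > 1` needed. As no element of B has negative `y`-degree,
D kills every `x_k` (`derivation_fromX_eq_zero`).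

Then `l(u) = u_0 l_0` with `l_0 ≠ 0`. An element of Ker D has `y`-degree 0, hence lies in `ℂ[x]`.
Since `D y` has `y`-degree `1 + E_0 ≥ 0`, an element of Ker D² has `y`-degree at most `1 < r`, hence
lies in `ℂ[x, y]`. For the Makar-Limanov invariant, the generator of any action is locally nilpotent
and so kills `ℂ[x]`; conversely, the one action `y ↦ y + x^m t` already has no invariants outside
`ℂ[x]`. -/

/-- The possible leading exponents of elements of the coordinate ring: the exponents of
`xᵅ yⁱ zʲ` with `i < r`, where `y` has exponent `(1, 0)` and `z` has exponent `(r, -m)`. -/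
def IsExponent {n : ℕ} (m : Fin n → ℕ) (r : ℕ) (d : ℤ) (u : Fin n → ℤ) : Prop :=
  ∃ (j i : ℕ) (α : Fin n → ℕ), i < r ∧ d = i + r * j ∧ ∀ k, u k = α k - j * m k

lemma IsExponent.nonneg {n : ℕ} {m : Fin n → ℕ} {r : ℕ} {d : ℤ} {u : Fin n → ℤ}
    (h : IsExponent m r d u) : 0 ≤ d := by
  obtain ⟨j, i, α, -, rfl, -⟩ := h
  positivity

/-- The functional `r u_k + m_k d` vanishes on `z` and on `x_l` for `l ≠ k`, and takes the values
`r` on `x_k` and `m_k` on `y`. It cuts out a facet of the cone of exponents. -/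
lemma IsExponent.exists_facet_eq {n : ℕ} {m : Fin n → ℕ} {r : ℕ} {d : ℤ} {u : Fin n → ℤ}
    (h : IsExponent m r d u) (k : Fin n) :
    ∃ j i a : ℕ, d = i + r * j ∧ r * u k + m k * d = r * a + m k * i := by
  obtain ⟨j, i, α, -, rfl, h⟩ := h
  exact ⟨j, i, α k, rfl, by rw [h]; ring⟩

lemma IsExponent.facet_nonneg {n : ℕ} {m : Fin n → ℕ} {r : ℕ} {d : ℤ} {u : Fin n → ℤ}
    (h : IsExponent m r d u) (k : Fin n) : 0 ≤ r * u k + m k * d := by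
  obtain ⟨j, i, a, -, h⟩ := h.exists_facet_eq k
  rw [h]
  positivity

/-- A monomial on the facet contains no `y`, so its `y`-degree comes from powers of `z` alone. -/
lemma IsExponent.dvd_of_facet_eq_zero {n : ℕ} {m : Fin n → ℕ} {r : ℕ} {d : ℤ} {u : Fin n → ℤ}
    (h : IsExponent m r d u) {k : Fin n} (hm : 0 < m k) (hk : r * u k + m k * d = 0) :
    (r : ℤ) ∣ d := by
  obtain ⟨j, i, a, hd, h⟩ := h.exists_facet_eq k
  rw [hk] at h
  have h1 : m k * i = 0 := by
    have : r * a + m k * i = 0 := by exact_mod_cast h.symm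
    exact (Nat.add_eq_zero_iff.1 this).2
  obtain rfl : i = 0 := (Nat.mul_eq_zero.1 h1).resolve_left hm.ne'
  exact ⟨j, by simpa using hd⟩

/-- A homogeneous locally nilpotent derivation of degree `(d, u)` on the toric ring spanned by the
exponents lowers the `y`-degree. The numbers `a k`, `b`, `c` are its orders of nilpotency on
`x k`, `y` and `z`. -/
theorem degree_neg_of_orders {n : ℕ} {m : Fin n → ℕ} {r : ℕ} (hm : ∀ i, 1 < m i) (hr : 2 ≤ r)
    {d : ℤ} {u : Fin n → ℤ} {a : Fin n → ℕ} {b c : ℕ}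
    (hsum : b * d + ∑ k, a k * u k = -1)
    (hc : (c : ℤ) = r * b - ∑ k, (m k : ℤ) * a k)
    (hx : ∀ i, ∀ j ≤ a i, IsExponent m r (j * d) (Pi.single i 1 + (j : ℤ) • u))
    (hy : IsExponent m r (1 + b * d) ((b : ℤ) • u))
    (hz : IsExponent m r (r + c * d) (fun k => -m k + c * u k)) : d < 0 := by
  by_contra! hd
  -- This is `r` times `hsum`, with `r b` eliminated through `hc`. If `d ≥ 0`, the negative total
  -- forces some facet functional to be negative on the degree.
  have key : ∑ k, a k * (r * u k + m k * d) + c * d = -r := by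
    have h1 : ∑ k, a k * (r * u k + m k * d)
        = r * ∑ k, a k * u k + (∑ k, (m k : ℤ) * a k) * d := by
      rw [Finset.mul_sum, Finset.sum_mul, ← Finset.sum_add_distrib]
      exact Finset.sum_congr rfl fun _ _ => by ring
    rw [h1, hc]
    linear_combination (r : ℤ) * hsum
  obtain ⟨i, hi⟩ : ∃ i, (r * u i + m i * d : ℤ) < 0 := by
    by_contra! h
    have h1 : (0 : ℤ) ≤ ∑ k, a k * (r * u k + m k * d) :=
      Finset.sum_nonneg fun k _ => mul_nonneg (by positivity) (h k)
    have h2 : (0 : ℤ) ≤ c * d := by positivity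
    omega
  -- `z`, and below each `x k` with `k ≠ i`, starts on the facet of `i`; any positive number of
  -- steps would leave the cone.
  have hc0 : c = 0 := by
    have h := hz.facet_nonneg i
    have h' : (0 : ℤ) ≤ c * (r * u i + m i * d) := by linarith
    by_contra hne
    have : (0 : ℤ) < c := by positivity
    nlinarith
  have ha0 : ∀ k, k ≠ i → a k = 0 := by
    intro k hk
    have h := (hx k _ le_rfl).facet_nonneg i
    simp only [Pi.add_apply, Pi.single_eq_of_ne hk.symm, Pi.smul_apply, smul_eq_mul] at h
    have h' : (0 : ℤ) ≤ a k * (r * u i + m i * d) := by linarith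
    by_contra hne
    have : (0 : ℤ) < a k := by positivity
    nlinarith
  rw [Finset.sum_eq_single i (fun k _ hk => by simp [ha0 k hk]) (by simp)] at hsum hc
  have hrb : (r * b : ℤ) = m i * a i := by rw [hc0] at hc; push_cast at hc; linarith
  have hmi : (1 : ℤ) < m i := by exact_mod_cast hm i
  have hr' : (2 : ℤ) ≤ r := by exact_mod_cast hr
  have hfac : (a i : ℤ) * (r * u i + m i * d) = -r := by
    linear_combination (r : ℤ) * hsum - d * hrb
  have ha : a i ≠ 0 := by
    intro h
    rw [h] at hfac
    push_cast at hfac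
    omega
  -- The strings of `x i` and of `y` both end exactly on the facet of `i`.
  have hdx : (r : ℤ) ∣ a i * d := by
    refine (hx i _ le_rfl).dvd_of_facet_eq_zero (k := i) (by have := hm i; omega) ?_
    simp only [Pi.add_apply, Pi.single_eq_same, Pi.smul_apply, smul_eq_mul]
    linear_combination hfac
  have hdy : (r : ℤ) ∣ 1 + b * d := by
    refine hy.dvd_of_facet_eq_zero (k := i) (by have := hm i; omega) ?_
    simp only [Pi.smul_apply, smul_eq_mul]
    linear_combination u i * hrb + m i * hsum
  have hab : a i = 1 ∨ b = 1 := by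
    -- One step before the end of the string of `x i`, the functional equals minus its value on the
    -- degree. Multiplying by `a i` gives `a i * f + b * e = 1` in natural numbers.
    obtain ⟨j, e, f, -, hef⟩ := (hx i (a i - 1) (by omega)).exists_facet_eq i
    simp only [Pi.add_apply, Pi.single_eq_same, Pi.smul_apply, smul_eq_mul] at hef
    rw [Nat.cast_sub (by omega)] at hef
    push_cast at hef
    have h1 : (r : ℤ) * (a i * f + b * e) = r * 1 := by
      linear_combination (-a i : ℤ) * hef + (e : ℤ) * hrb + (a i - 1 : ℤ) * hfac
    have h2 : a i * f + b * e = 1 := by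
      exact_mod_cast mul_left_cancel₀ (by omega) h1
    rcases Nat.eq_zero_or_pos (a i * f) with h | h
    · exact Or.inr (Nat.eq_one_of_mul_eq_one_right (by omega : b * e = 1))
    · exact Or.inl (Nat.eq_one_of_mul_eq_one_right (by omega : a i * f = 1))
  rcases hab with h | h
  · rw [h] at hdx
    have h1 : (r : ℤ) ∣ 1 := by
      have h2 := dvd_sub hdy (hdx.mul_left (b : ℤ))
      have h3 : 1 + b * d - b * ((1 : ℕ) * d) = 1 := by push_cast; ring
      rwa [h3] at h2
    have := Int.le_of_dvd one_pos h1
    omega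
  · rw [h] at hrb hdy
    push_cast at hrb hdy
    have h0 : (a i : ℤ) ≠ 0 := by exact_mod_cast ha
    have h1 : (m i : ℤ) ∣ d := by
      refine (mul_dvd_mul_iff_left h0).1 ?_
      rwa [mul_comm, ← hrb, mul_one]
    have h2 : (m i : ℤ) ∣ 1 + 1 * d := dvd_trans ⟨a i, by rw [← hrb, mul_one]⟩ hdy
    have h3 : (m i : ℤ) ∣ 1 := by
      have := dvd_sub h2 h1
      have h4 : 1 + 1 * d - d = 1 := by ring
      rwa [h4] at this
    have := Int.le_of_dvd one_pos h3
    omega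

/-! ### Leading terms and logarithmic derivations in group algebras -/

section GroupAlgebra

variable {k G : Type*} [CommRing k]

section Top

variable [LinearOrder G]

/-- All exponents of `h` are at most `u`, and the coefficient of `h` at `u` is `c`. -/
def HasTop (h : AddMonoidAlgebra k G) (u : G) (c : k) : Prop :=
  h.coeff u = c ∧ ∀ v, u < v → h.coeff v = 0

lemma hasTop_single (u : G) (c : k) : HasTop (AddMonoidAlgebra.single u c) u c :=
  ⟨by simp [AddMonoidAlgebra.coeff_single], fun v hv => by
    simp [AddMonoidAlgebra.coeff_single, hv.ne]⟩

lemma HasTop.add {h h' : AddMonoidAlgebra k G} {u : G} {c c' : k} (H : HasTop h u c)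
    (H' : HasTop h' u c') : HasTop (h + h') u (c + c') :=
  ⟨by simp [AddMonoidAlgebra.coeff_add, H.1, H'.1], fun v hv => by
    simp [AddMonoidAlgebra.coeff_add, H.2 v hv, H'.2 v hv]⟩

lemma HasTop.of_lt {h : AddMonoidAlgebra k G} {u v : G} {c : k} (H : HasTop h u c)
    (hv : u < v) : HasTop h v 0 :=
  ⟨H.2 v hv, fun w hw => H.2 w (hv.trans hw)⟩

lemma HasTop.unique {h : AddMonoidAlgebra k G} {u u' : G} {c c' : k} (H : HasTop h u c)
    (H' : HasTop h u' c') (hc : c ≠ 0) (hc' : c' ≠ 0) : u = u' := by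
  rcases lt_trichotomy u u' with hlt | rfl | hlt
  · exact absurd (H'.1.symm.trans (H.2 _ hlt)) hc'
  · rfl
  · exact absurd (H.1.symm.trans (H'.2 _ hlt)) hc

lemma HasTop.ne_zero {h : AddMonoidAlgebra k G} {u : G} {c : k} (H : HasTop h u c)
    (hc : c ≠ 0) : h ≠ 0 := by
  rintro rfl
  exact hc (by simpa using H.1.symm)

lemma exists_hasTop {h : AddMonoidAlgebra k G} (hh : h ≠ 0) :
    ∃ u c, c ≠ 0 ∧ HasTop h u c := by
  have hne : h.coeff.support.Nonempty := by
    rw [Finsupp.support_nonempty_iff]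
    simpa using hh
  refine ⟨h.coeff.support.max' hne, h.coeff (h.coeff.support.max' hne),
    Finsupp.mem_support_iff.1 (Finset.max'_mem _ hne), rfl, fun v hv => ?_⟩
  by_contra h0
  exact absurd (Finset.le_max' _ v (Finsupp.mem_support_iff.2 h0)) (not_le.2 hv)

end Top

section LogDeriv

variable [AddCommGroup G]

/-- The derivation of the group algebra with `χᵛ ↦ χᵛ Λ(v)`. -/
def logDeriv (Λ : G →+ AddMonoidAlgebra k G) (h : AddMonoidAlgebra k G) : AddMonoidAlgebra k G :=
  h.coeff.sum fun v a => AddMonoidAlgebra.single v a * Λ v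

lemma logDeriv_add (Λ : G →+ AddMonoidAlgebra k G) (h h' : AddMonoidAlgebra k G) :
    logDeriv Λ (h + h') = logDeriv Λ h + logDeriv Λ h' :=
  Finsupp.sum_add_index' (by simp) (by simp [AddMonoidAlgebra.single_add, add_mul])

lemma logDeriv_single (Λ : G →+ AddMonoidAlgebra k G) (v : G) (a : k) :
    logDeriv Λ (AddMonoidAlgebra.single v a) = AddMonoidAlgebra.single v a * Λ v :=
  Finsupp.sum_single_index (by simp)

lemma logDeriv_mul (Λ : G →+ AddMonoidAlgebra k G) (h h' : AddMonoidAlgebra k G) :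
    logDeriv Λ (h * h') = h * logDeriv Λ h' + h' * logDeriv Λ h := by
  induction h using AddMonoidAlgebra.induction_linear with
  | zero => simp [logDeriv]
  | add x y hx hy => rw [add_mul, logDeriv_add, logDeriv_add, hx, hy]; ring
  | single v a =>
    induction h' using AddMonoidAlgebra.induction_linear with
    | zero => simp [logDeriv]
    | add x y hx hy => rw [mul_add, logDeriv_add, logDeriv_add, hx, hy]; ring
    | single w b =>
      rw [AddMonoidAlgebra.single_mul_single, logDeriv_single, logDeriv_single, logDeriv_single,
        map_add, ← AddMonoidAlgebra.single_mul_single]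
      ring

end LogDeriv

variable [AddCommGroup G] [LinearOrder G] [IsOrderedAddMonoid G]

/-- Terms with `v < u` stay below `u + E`, so only `v = u` reaches it. A constant `f` gives
products, and `f = Λ` gives `logDeriv`. -/
lemma hasTop_sum_mul {h : AddMonoidAlgebra k G} {u E : G} {c : k} (H : HasTop h u c)
    {f : G → AddMonoidAlgebra k G} {l : G → k} (hf : ∀ v, HasTop (f v) E (l v)) :
    HasTop (h.coeff.sum fun v a => AddMonoidAlgebra.single v a * f v) (u + E) (c * l u) := by
  have hterm : ∀ v w a, (AddMonoidAlgebra.single v a * f v).coeff w = a * (f v).coeff (-v + w) :=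
    fun v w a => AddMonoidAlgebra.coeff_single_mul_apply _ _ _ _
  have hcoeff : ∀ w, (h.coeff.sum fun v a => AddMonoidAlgebra.single v a * f v).coeff w
      = h.coeff.sum fun v a => a * (f v).coeff (-v + w) := by
    intro w
    simp only [Finsupp.sum, AddMonoidAlgebra.coeff_sum, Finsupp.finsetSum_apply, hterm]
  constructor
  · rw [hcoeff, Finsupp.sum, Finset.sum_eq_single u]
    · rw [neg_add_cancel_left, (hf u).1, H.1]
    · intro v hv hne
      rcases lt_or_gt_of_ne hne with hlt | hlt
      · rw [(hf v).2 _ (by rw [lt_neg_add_iff_add_lt]; exact add_lt_add_left hlt E), mul_zero]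
      · rw [H.2 v hlt, zero_mul]
    · intro hu
      rw [Finsupp.notMem_support_iff.1 hu, zero_mul]
  · intro w hw
    rw [hcoeff]
    refine Finset.sum_eq_zero fun v _ => ?_
    dsimp only
    rcases lt_or_ge u v with hlt | hle
    · rw [H.2 v hlt, zero_mul]
    · rw [(hf v).2 _ (by
        rw [lt_neg_add_iff_add_lt]; exact (add_le_add_left hle E).trans_lt hw), mul_zero]

lemma HasTop.mul {h h' : AddMonoidAlgebra k G} {u u' : G} {c c' : k} (H : HasTop h u c)
    (H' : HasTop h' u' c') : HasTop (h * h') (u + u') (c * c') := by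
  have := hasTop_sum_mul H (fun _ => H')
  rwa [← Finsupp.sum_mul, AddMonoidAlgebra.sum_coeff_single] at this

lemma HasTop.logDeriv {Λ : G →+ AddMonoidAlgebra k G} {E : G} {l : G → k}
    (hΛ : ∀ v, HasTop (Λ v) E (l v)) {h : AddMonoidAlgebra k G} {u : G} {c : k}
    (H : HasTop h u c) : HasTop (logDeriv Λ h) (u + E) (c * l u) :=
  hasTop_sum_mul H hΛ

end GroupAlgebra

/-! ### The embedding into the ring of Laurent polynomials -/

/-- Exponents of Laurent monomials in `y, x₁, …, xₙ`, ordered lexicographically with `y` first. -/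
abbrev Exponent (n : ℕ) : Type := Lex (Fin (n + 1) → ℤ)

lemma Exponent.lt_of_zero_lt {n : ℕ} {u v : Exponent n} (h : u 0 < v 0) : u < v :=
  ⟨0, fun j hj => absurd hj (Fin.not_lt_zero j), h⟩

lemma Exponent.zero_le_zero {n : ℕ} {u v : Exponent n} (h : u ≤ v) : u 0 ≤ v 0 := by
  by_contra! hlt
  exact absurd (lt_of_zero_lt hlt) (not_lt.2 h)

/-- The exponent of a variable. -/
def basisExponent {n : ℕ} (i : Fin (n + 1)) : Exponent n := toLex (Pi.single i 1)

/-- The exponent of `xᵅ yᵈ`. -/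
def monomialExponent {n : ℕ} (d : ℕ) (α : Fin n →₀ ℕ) : Exponent n :=
  toLex (Fin.cons (d : ℤ) fun i => (α i : ℤ))

lemma monomialExponent_add {n : ℕ} (d d' : ℕ) (α α' : Fin n →₀ ℕ) :
    monomialExponent (d + d') (α + α') = monomialExponent d α + monomialExponent d' α' := by
  funext i
  refine Fin.cases ?_ (fun i => ?_) i
  · exact Nat.cast_add d d'
  · exact Nat.cast_add (α i) (α' i)

lemma monomialExponent_zero {n : ℕ} : monomialExponent 0 (0 : Fin n →₀ ℕ) = 0 := by
  funext i
  refine Fin.cases ?_ (fun i => ?_) i <;> rfl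

lemma monomialExponent_injective {n : ℕ} {d d' : ℕ} {α α' : Fin n →₀ ℕ}
    (h : monomialExponent d α = monomialExponent d' α') : d = d' ∧ α = α' := by
  constructor
  · have := congr_fun h 0
    exact Int.ofNat_inj.1 this
  · ext i
    have := congr_fun h i.succ
    exact Int.ofNat_inj.1 this

lemma monomialExponent_one_zero {n : ℕ} : monomialExponent 1 (0 : Fin n →₀ ℕ) = basisExponent 0 := by
  funext i
  refine Fin.cases ?_ (fun i => ?_) i
  · rfl
  · change (0 : ℤ) = (Pi.single 0 1 : Fin (n + 1) → ℤ) i.succ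
    simp

lemma monomialExponent_zero_single {n : ℕ} (k : Fin n) :
    monomialExponent 0 (Finsupp.single k 1) = basisExponent k.succ := by
  funext i
  refine Fin.cases ?_ (fun i => ?_) i
  · change (0 : ℤ) = (Pi.single k.succ 1 : Fin (n + 1) → ℤ) 0
    simp
  · change ((Finsupp.single k 1 : Fin n →₀ ℕ) i : ℤ) = (Pi.single k.succ 1 : Fin (n + 1) → ℤ) i.succ
    simp [Finsupp.single_apply, Pi.single_apply, eq_comm]

/-- Laurent polynomials in `y, x₁, …, xₙ`. -/
abbrev Laurent (n : ℕ) : Type := AddMonoidAlgebra ℂ (Exponent n)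

/-- The inclusion of `ℂ[x₁, …, xₙ, y]` into the Laurent polynomials. -/
def polyToLaurent (n : ℕ) : (MvPolynomial (Fin n) ℂ)[X] →ₐ[ℂ] Laurent n :=
  Polynomial.eval₂AlgHom
    (MvPolynomial.aeval fun i => AddMonoidAlgebra.single (basisExponent i.succ) 1)
    (AddMonoidAlgebra.single (basisExponent 0) 1) fun _ => Commute.all _ _

lemma polyToLaurent_X (n : ℕ) :
    polyToLaurent n X = AddMonoidAlgebra.single (basisExponent 0) 1 :=
  eval₂_X _ _

lemma polyToLaurent_C_X {n : ℕ} (i : Fin n) :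
    polyToLaurent n (C (MvPolynomial.X i))
      = AddMonoidAlgebra.single (basisExponent i.succ) 1 :=
  (eval₂_C _ _).trans (MvPolynomial.aeval_X _ _)

lemma polyToLaurent_C_C {n : ℕ} (c : ℂ) :
    polyToLaurent n (C (MvPolynomial.C c)) = AddMonoidAlgebra.single 0 c := by
  refine (eval₂_C _ _).trans ?_
  change MvPolynomial.aeval _ (MvPolynomial.C c) = _
  rw [MvPolynomial.aeval_C]
  rfl

lemma polyToLaurent_monomial {n : ℕ} (d : ℕ) (α : Fin n →₀ ℕ) (c : ℂ) :
    polyToLaurent n (monomial d (MvPolynomial.monomial α c))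
      = AddMonoidAlgebra.single (monomialExponent d α) c := by
  have hy : ∀ d : ℕ, (polyToLaurent n X) ^ d
      = AddMonoidAlgebra.single (monomialExponent d 0) 1 := by
    intro d
    induction d with
    | zero => rw [pow_zero, monomialExponent_zero]; rfl
    | succ d ih =>
      rw [pow_succ, ih, polyToLaurent_X, AddMonoidAlgebra.single_mul_single, one_mul,
        ← monomialExponent_one_zero, ← monomialExponent_add, add_zero]
  have hx : ∀ (k : Fin n) (e : ℕ), (polyToLaurent n (C (MvPolynomial.X k))) ^ e
      = AddMonoidAlgebra.single (monomialExponent 0 (Finsupp.single k e)) 1 := by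
    intro k e
    induction e with
    | zero => rw [pow_zero, Finsupp.single_zero, monomialExponent_zero]; rfl
    | succ d ih =>
      rw [pow_succ, ih, polyToLaurent_C_X, AddMonoidAlgebra.single_mul_single, one_mul,
        ← monomialExponent_zero_single, ← monomialExponent_add, add_zero, Finsupp.single_add]
  have hα : polyToLaurent n (C (MvPolynomial.monomial α c))
      = AddMonoidAlgebra.single (monomialExponent 0 α) c := by
    induction α using Finsupp.induction with
    | zero => rw [monomialExponent_zero]; exact polyToLaurent_C_C c
    | single_add k e α hk he ih =>
      rw [add_comm (Finsupp.single k e) α, MvPolynomial.monomial_add_single, C_mul, map_mul, ih, C_pow, map_pow, hx,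
        AddMonoidAlgebra.single_mul_single, mul_one, ← monomialExponent_add]
  rw [← C_mul_X_pow_eq_monomial, map_mul, map_pow, hα, hy, AddMonoidAlgebra.single_mul_single,
    mul_one, ← monomialExponent_add, zero_add, add_zero]

@[elab_as_elim]
lemma poly_induction {n : ℕ} {P : (MvPolynomial (Fin n) ℂ)[X] → Prop}
    (add : ∀ p q, P p → P q → P (p + q))
    (mon : ∀ d α c, P (monomial d (MvPolynomial.monomial α c)))
    (p : (MvPolynomial (Fin n) ℂ)[X]) : P p := by
  induction p using Polynomial.induction_on' with
  | add p q hp hq => exact add p q hp hq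
  | monomial d a =>
    induction a using MvPolynomial.induction_on' with
    | monomial α c => exact mon d α c
    | add a b ha hb => rw [map_add]; exact add _ _ ha hb

lemma coeff_polyToLaurent {n : ℕ} (p : (MvPolynomial (Fin n) ℂ)[X]) (d : ℕ) (α : Fin n →₀ ℕ) :
    (polyToLaurent n p).coeff (monomialExponent d α) = MvPolynomial.coeff α (p.coeff d) := by
  classical
  induction p using poly_induction with
  | add p q hp hq => simp [AddMonoidAlgebra.coeff_add, hp, hq]
  | mon e β c =>
    rw [polyToLaurent_monomial, AddMonoidAlgebra.coeff_single, Finsupp.single_apply,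
      coeff_monomial]
    by_cases h : monomialExponent e β = monomialExponent d α
    · obtain ⟨rfl, rfl⟩ := monomialExponent_injective h
      simp
    · rw [if_neg h]
      split_ifs with hd
      · subst hd
        rw [MvPolynomial.coeff_monomial, if_neg]
        rintro rfl
        exact h rfl
      · simp

lemma exists_of_coeff_polyToLaurent_ne_zero {n : ℕ} {p : (MvPolynomial (Fin n) ℂ)[X]}
    {u : Exponent n} (h : (polyToLaurent n p).coeff u ≠ 0) :
    ∃ d α, u = monomialExponent d α := by
  induction p using poly_induction with
  | add p q hp hq =>
    by_contra hn
    refine h ?_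
    rw [map_add, AddMonoidAlgebra.coeff_add, Finsupp.add_apply, not_not.1 fun h => hn (hp h),
      not_not.1 fun h => hn (hq h), add_zero]
  | mon e β c =>
    rw [polyToLaurent_monomial, AddMonoidAlgebra.coeff_single] at h
    exact ⟨e, β, by_contra fun hne => h (Finsupp.single_eq_of_ne hne)⟩

lemma polyToLaurent_injective (n : ℕ) : Function.Injective (polyToLaurent n) := by
  rw [injective_iff_map_eq_zero]
  intro p hp
  ext d α
  rw [← coeff_polyToLaurent, hp]
  simp

/-- The leading exponent of a polynomial has the `y`-degree as its first entry. -/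
lemma exists_hasTop_polyToLaurent {n : ℕ} {p : (MvPolynomial (Fin n) ℂ)[X]} (hp : p ≠ 0) :
    ∃ (α : Fin n →₀ ℕ) (c : ℂ), c ≠ 0 ∧
      HasTop (polyToLaurent n p) (monomialExponent p.natDegree α) c := by
  obtain ⟨u, c, hc, hu⟩ :=
    exists_hasTop ((map_ne_zero_iff _ (polyToLaurent_injective n)).2 hp)
  obtain ⟨d, α, rfl⟩ := exists_of_coeff_polyToLaurent_ne_zero (hu.1 ▸ hc)
  obtain ⟨β, hβ⟩ := MvPolynomial.ne_zero_iff.1 (leadingCoeff_ne_zero.2 hp)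
  have h1 : p.natDegree ≤ d := by
    have hle : monomialExponent p.natDegree β ≤ monomialExponent d α := by
      by_contra! hlt
      refine hβ ?_
      rw [leadingCoeff, ← coeff_polyToLaurent]
      exact hu.2 _ hlt
    have := Exponent.zero_le_zero hle
    exact Int.ofNat_le.1 this
  have h2 : d ≤ p.natDegree := by
    by_contra! hlt
    refine hc (hu.1.symm.trans ?_)
    rw [coeff_polyToLaurent, coeff_eq_zero_of_natDegree_lt hlt, MvPolynomial.coeff_zero]
  obtain rfl := le_antisymm h1 h2
  exact ⟨α, c, hc, hu⟩

/-- Monicity makes the leading monomial a pure power of `y`; this fixes the exponent of `z`. -/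
lemma hasTop_polyToLaurent_monic {n : ℕ} {Q : (MvPolynomial (Fin n) ℂ)[X]} (hQ : Q.Monic) :
    HasTop (polyToLaurent n Q) (monomialExponent Q.natDegree 0) 1 := by
  obtain ⟨α, c, hc, h⟩ := exists_hasTop_polyToLaurent hQ.ne_zero
  have h1 := h.1
  rw [coeff_polyToLaurent, coeff_natDegree, hQ.leadingCoeff, MvPolynomial.coeff_one] at h1
  split_ifs at h1 with h0
  · rwa [h0, h1]
  · exact absurd h1.symm hc

/-! ### The coordinate ring inside the Laurent polynomials: normal forms and leading exponents -/

section CoordRing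

variable {n : ℕ} (m : Fin n → ℕ) (Q : (MvPolynomial (Fin n) ℂ)[X])

/-- The exponent of `x₁^(m₁) ⋯ xₙ^(mₙ)`. -/
def xExponent : Exponent n := monomialExponent 0 (Finsupp.equivFunOnFinite.symm m)

lemma xMonomial_eq_monomial :
    xMonomial m = MvPolynomial.monomial (Finsupp.equivFunOnFinite.symm m) 1 := by
  rw [MvPolynomial.monomial_eq, xMonomial, map_one, one_mul, Finsupp.prod_fintype _ _ (by simp)]
  rfl

lemma polyToLaurent_xMonomial :
    polyToLaurent n (C (xMonomial m)) = AddMonoidAlgebra.single (xExponent m) 1 := by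
  rw [xMonomial_eq_monomial]
  exact polyToLaurent_monomial 0 _ _

lemma eval₂_equation_eq {S : Type*} [CommRing S] (f : (MvPolynomial (Fin n) ℂ)[X] →+* S) (s : S) :
    (equation m Q).eval₂ f s = f (C (xMonomial m)) * s - f Q := by
  rw [equation, eval₂_sub, eval₂_mul, eval₂_C, eval₂_X, eval₂_C]

lemma eval₂_equation :
    (equation m Q).eval₂ (polyToLaurent n : (MvPolynomial (Fin n) ℂ)[X] →+* Laurent n)
      (AddMonoidAlgebra.single (-xExponent m) 1 * polyToLaurent n Q) = 0 := by
  rw [eval₂_equation_eq, RingHom.coe_coe, polyToLaurent_xMonomial, ← mul_assoc,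
    AddMonoidAlgebra.single_mul_single, add_neg_cancel, one_mul, ← AddMonoidAlgebra.one_def, one_mul, sub_self]

/-- The embedding of the coordinate ring into the Laurent polynomials. -/
def toLaurent : CoordRing m Q →ₐ[ℂ] Laurent n :=
  AdjoinRoot.liftAlgHom _ (polyToLaurent n) _ (eval₂_equation m Q)

/-- The class of `z`. -/
def zElem : CoordRing m Q := AdjoinRoot.root _

lemma toLaurent_fromXY (p : (MvPolynomial (Fin n) ℂ)[X]) :
    toLaurent m Q (fromXY m Q p) = polyToLaurent n p :=
  AdjoinRoot.liftAlgHom_of _ _ _ _ _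

lemma toLaurent_zElem :
    toLaurent m Q (zElem m Q)
      = AddMonoidAlgebra.single (-xExponent m) 1 * polyToLaurent n Q :=
  AdjoinRoot.liftAlgHom_root _ _ _ _

lemma xMonomial_mul_zElem : fromXY m Q (C (xMonomial m)) * zElem m Q = fromXY m Q Q := by
  have h : AdjoinRoot.mk (equation m Q) (equation m Q) = 0 := AdjoinRoot.mk_self
  rw [equation, map_sub, map_mul, sub_eq_zero] at h
  exact h

/-- The exponent of `z`. -/
def zExponent : Exponent n := -xExponent m + monomialExponent Q.natDegree 0

lemma zExponent_zero : zExponent m Q 0 = Q.natDegree := by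
  change -((0 : ℕ) : ℤ) + (Q.natDegree : ℤ) = _
  simp

lemma zExponent_succ (i : Fin n) : zExponent m Q i.succ = -m i := by
  change -((m i : ℕ) : ℤ) + ((0 : ℕ) : ℤ) = _
  simp

variable {Q}

lemma hasTop_toLaurent_zElem (hQ : Q.Monic) :
    HasTop (toLaurent m Q (zElem m Q)) (zExponent m Q) 1 := by
  rw [toLaurent_zElem]
  have := (hasTop_single (-xExponent m) (1 : ℂ)).mul (hasTop_polyToLaurent_monic hQ)
  rwa [one_mul] at this

variable {m}

/-- Every element of the coordinate ring has the form `∑ pⱼ zʲ` with `pⱼ` of `y`-degree less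
than that of `Q`. -/
lemma CoordRing.horner_induction (hQ : Q.Monic) (hd : 0 < Q.natDegree) {P : CoordRing m Q → Prop} (zero : P 0)
    (step : ∀ p b, p.degree < Q.degree → P b → P (fromXY m Q p + zElem m Q * b))
    (b : CoordRing m Q) : P b := by
  -- The smallest set closed under the Horner step; it remains to see that it is everything.
  let T : Set (CoordRing m Q) := {b | ∀ P : CoordRing m Q → Prop, P 0 →
    (∀ p b, p.degree < Q.degree → P b → P (fromXY m Q p + zElem m Q * b)) → P b}
  have hstep : ∀ p b, p.degree < Q.degree → b ∈ T → fromXY m Q p + zElem m Q * b ∈ T :=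
    fun p b hp hb P h0 hs => hs p b hp (hb P h0 hs)
  have hz : ∀ b ∈ T, zElem m Q * b ∈ T := by
    intro b hb
    have := hstep 0 b (by rw [degree_zero]; exact bot_lt_iff_ne_bot.2 (degree_ne_bot.2 hQ.ne_zero)) hb
    rwa [map_zero, zero_add] at this
  have hadd : ∀ a ∈ T, ∀ b ∈ T, a + b ∈ T := by
    intro a ha
    refine ha (fun a => ∀ b ∈ T, a + b ∈ T) (fun b hb => by rwa [zero_add]) ?_
    intro p a hp iha b hb
    -- The recursion principle of `T` does not remember membership, so it is carried along.
    have key : (fromXY m Q p + zElem m Q * a + b ∈ T) ∧ b ∈ T := by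
      refine hb (fun b => (fromXY m Q p + zElem m Q * a + b ∈ T) ∧ b ∈ T) ⟨?_, ?_⟩ ?_
      · rw [add_zero]
        refine hstep p a hp ?_
        have := iha 0 (fun P h0 _ => h0)
        rwa [add_zero] at this
      · exact fun P h0 _ => h0
      · intro q b hq hb
        refine ⟨?_, hstep q b hq hb.2⟩
        have := hstep (p + q) (a + b) ((degree_add_le p q).trans_lt (max_lt hp hq)) (iha b hb.2)
        convert this using 1
        rw [map_add]
        ring
    exact key.1
  have hpoly : ∀ (d : ℕ) (p : (MvPolynomial (Fin n) ℂ)[X]), p.natDegree ≤ d →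
      fromXY m Q p ∈ T := by
    intro d
    induction d using Nat.strong_induction_on with
    | _ d ih =>
      intro p hp
      by_cases hlt : p.degree < Q.degree
      · have := hstep p 0 hlt (fun P h0 _ => h0)
        rwa [mul_zero, add_zero] at this
      -- Replacing `Q` by `x^m z` in `p = p %ₘ Q + Q (p /ₘ Q)` makes this the coefficient of `z`;
      -- its `y`-degree has dropped.
      have hq : fromXY m Q (p /ₘ Q * C (xMonomial m)) ∈ T := by
        have hle : Q.natDegree ≤ p.natDegree := natDegree_le_natDegree (not_lt.1 hlt)
        refine ih _ ?_ _ le_rfl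
        have h1 := natDegree_mul_C_le (p /ₘ Q) (xMonomial m)
        rw [natDegree_divByMonic p hQ] at h1
        omega
      have := hstep (p %ₘ Q) _ (degree_modByMonic_lt p hQ) hq
      convert this using 1
      rw [map_mul, mul_comm (fromXY m Q (p /ₘ Q)), ← mul_assoc, mul_comm (zElem m Q),
        xMonomial_mul_zElem, ← map_mul, ← map_add, modByMonic_add_div]
  have hall : b ∈ T := by
    obtain ⟨F, rfl⟩ := AdjoinRoot.mk_surjective b
    induction F using Polynomial.induction_on' with
    | add p q hp hq => rw [map_add]; exact hadd _ hp _ hq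
    | monomial k a =>
      rw [← C_mul_X_pow_eq_monomial, map_mul, map_pow, mul_comm]
      change zElem m Q ^ k * fromXY m Q a ∈ T
      induction k with
      | zero => rw [pow_zero, one_mul]; exact hpoly _ a le_rfl
      | succ k ih => rw [pow_succ', mul_assoc]; exact hz _ ih
  exact hall P zero step

/-- In a Horner step `p + z b` with `b ≠ 0`, the `y`-degree of `z b` is at least `r` and that of `p`
is smaller, so the leading term is that of `z b`. In particular, `y`-degree below `r` means that no
`z` occurs. -/
lemma exists_hasTop_or_eq_zero (hQ : Q.Monic) (hd : 0 < Q.natDegree) (b : CoordRing m Q) :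
    b = 0 ∨ ∃ u c, c ≠ 0 ∧ HasTop (toLaurent m Q b) u c ∧
      IsExponent m Q.natDegree (u 0) (fun i => u i.succ) ∧
      (u 0 < Q.natDegree → ∃ p : (MvPolynomial (Fin n) ℂ)[X], fromXY m Q p = b) := by
  induction b using CoordRing.horner_induction hQ hd with
  | zero => exact Or.inl rfl
  | step p b hp ih =>
    rcases ih with rfl | ⟨u, c, hc, hu, ⟨j, i, α, hi, h0, hα⟩, -⟩
    · rw [mul_zero, add_zero]
      by_cases h0 : p = 0
      · left
        rw [h0, map_zero]
      right
      obtain ⟨α, c, hc, hu⟩ := exists_hasTop_polyToLaurent h0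
      refine ⟨_, c, hc, by rwa [toLaurent_fromXY], ?_, fun _ => ⟨p, rfl⟩⟩
      refine ⟨0, p.natDegree, α, natDegree_lt_natDegree h0 hp, ?_, fun k => ?_⟩
      · rw [Nat.cast_zero, mul_zero, add_zero]
        rfl
      · rw [Nat.cast_zero, zero_mul, sub_zero]
        rfl
    · right
      have hsum0 : (zExponent m Q + u) 0 = Q.natDegree + u 0 :=
        congrArg (· + u 0) (zExponent_zero m Q)
      refine ⟨zExponent m Q + u, c, hc, ?_, ⟨j + 1, i, α, hi, ?_, fun k => ?_⟩, fun hlt => ?_⟩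
      · rw [map_add, map_mul, toLaurent_fromXY]
        have hzb := (hasTop_toLaurent_zElem m hQ).mul hu
        rw [one_mul] at hzb
        have hp0 : HasTop (polyToLaurent n p) (zExponent m Q + u) 0 := by
          by_cases hp0 : p = 0
          · rw [hp0, map_zero]
            exact ⟨rfl, fun _ _ => rfl⟩
          obtain ⟨β, e, he, hv⟩ := exists_hasTop_polyToLaurent hp0
          refine hv.of_lt (Exponent.lt_of_zero_lt ?_)
          change ((p.natDegree : ℕ) : ℤ) < _
          rw [hsum0, h0]
          have := natDegree_lt_natDegree hp0 hp
          have h1 : (0 : ℤ) ≤ i + Q.natDegree * j := by positivity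
          omega
        have := hp0.add hzb
        rwa [zero_add] at this
      · rw [hsum0, h0]
        push_cast
        ring
      · change zExponent m Q k.succ + u k.succ = _
        rw [zExponent_succ, show u k.succ = _ from hα k]
        push_cast
        ring
      · rw [hsum0, h0] at hlt
        have h1 : (0 : ℤ) ≤ i + Q.natDegree * j := by positivity
        omega

lemma toLaurent_injective (hQ : Q.Monic) (hd : 0 < Q.natDegree) :
    Function.Injective (toLaurent m Q) := by
  rw [injective_iff_map_eq_zero]
  intro b hb
  refine (exists_hasTop_or_eq_zero hQ hd b).resolve_right ?_
  rintro ⟨u, c, hc, hu, -⟩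
  exact hu.ne_zero hc hb

lemma isExponent_of_hasTop (hQ : Q.Monic) (hd : 0 < Q.natDegree) {b : CoordRing m Q}
    {u : Exponent n} {c : ℂ} (hc : c ≠ 0) (hu : HasTop (toLaurent m Q b) u c) :
    IsExponent m Q.natDegree (u 0) (fun i => u i.succ) := by
  rcases exists_hasTop_or_eq_zero hQ hd b with rfl | ⟨v, e, he, hv, h, -⟩
  · exact absurd (map_zero _) (hu.ne_zero hc)
  · rwa [hu.unique hv hc he]

lemma exists_fromXY_of_hasTop (hQ : Q.Monic) (hd : 0 < Q.natDegree) {b : CoordRing m Q}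
    {u : Exponent n} {c : ℂ} (hc : c ≠ 0) (hu : HasTop (toLaurent m Q b) u c)
    (hlt : u 0 < Q.natDegree) :
    ∃ p : (MvPolynomial (Fin n) ℂ)[X], (p.natDegree : ℤ) = u 0 ∧ fromXY m Q p = b := by
  rcases exists_hasTop_or_eq_zero hQ hd b with rfl | ⟨v, e, he, hv, -, h⟩
  · exact absurd (map_zero _) (hu.ne_zero hc)
  · obtain rfl := hu.unique hv hc he
    obtain ⟨p, rfl⟩ := h hlt
    rw [toLaurent_fromXY] at hu
    have hp : p ≠ 0 := by
      rintro rfl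
      exact hu.ne_zero hc (map_zero _)
    obtain ⟨α, e, he, hw⟩ := exists_hasTop_polyToLaurent hp
    obtain rfl := hu.unique hw hc he
    exact ⟨p, rfl, rfl⟩

lemma mem_range_fromX_of_hasTop (hQ : Q.Monic) (hd : 0 < Q.natDegree) {b : CoordRing m Q}
    {u : Exponent n} {c : ℂ} (hc : c ≠ 0) (hu : HasTop (toLaurent m Q b) u c)
    (h0 : u 0 = 0) : b ∈ (fromX m Q).range := by
  obtain ⟨p, hp, rfl⟩ := exists_fromXY_of_hasTop hQ hd hc hu (by rw [h0]; exact_mod_cast hd)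
  rw [h0] at hp
  rw [eq_C_of_natDegree_eq_zero (by exact_mod_cast hp : p.natDegree = 0)]
  exact ⟨p.coeff 0, rfl⟩

lemma fromX_injective (m : Fin n → ℕ) (Q : (MvPolynomial (Fin n) ℂ)[X]) :
    Function.Injective (fromX m Q) := by
  intro a b hab
  have h : polyToLaurent n (C a) = polyToLaurent n (C b) := by
    rw [← toLaurent_fromXY m Q, ← toLaurent_fromXY m Q]
    exact congrArg _ hab
  exact C_injective (polyToLaurent_injective n h)

lemma fromX_xMonomial_ne_zero (m : Fin n → ℕ) (Q : (MvPolynomial (Fin n) ℂ)[X]) :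
    fromX m Q (xMonomial m) ≠ 0 := by
  rw [map_ne_zero_iff _ (fromX_injective m Q), xMonomial_eq_monomial, Ne,
    MvPolynomial.monomial_eq_zero]
  exact one_ne_zero

lemma CoordRing.isDomain (hQ : Q.Monic) (hd : 0 < Q.natDegree) : IsDomain (CoordRing m Q) :=
  (toLaurent_injective hQ hd).isDomain (toLaurent m Q).toRingHom

end CoordRing

section Derivations

variable {n : ℕ} {m : Fin n → ℕ} {Q : (MvPolynomial (Fin n) ℂ)[X]}

/-! ### Derivations of the coordinate ring -/

/-- The classes of `y, x₁, …, xₙ`. -/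
def gen (m : Fin n → ℕ) (Q : (MvPolynomial (Fin n) ℂ)[X]) (k : Fin (n + 1)) : CoordRing m Q :=
  Fin.cases (fromXY m Q X) (fun i => fromX m Q (MvPolynomial.X i)) k

lemma toLaurent_gen (k : Fin (n + 1)) :
    toLaurent m Q (gen m Q k) = AddMonoidAlgebra.single (basisExponent k) 1 := by
  refine Fin.cases ?_ (fun i => ?_) k
  · exact (toLaurent_fromXY m Q _).trans (polyToLaurent_X n)
  · exact (toLaurent_fromXY m Q _).trans (polyToLaurent_C_X i)

lemma fromX_induction {P : CoordRing m Q → Prop}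
    (add : ∀ a b, P a → P b → P (a + b)) (mul : ∀ a b, P a → P b → P (a * b))
    (const : ∀ c : ℂ, P (algebraMap ℂ _ c)) (hgen : ∀ i : Fin n, P (gen m Q i.succ))
    (a : MvPolynomial (Fin n) ℂ) : P (fromX m Q a) := by
  induction a using MvPolynomial.induction_on with
  | C c =>
    have := const c
    rwa [← (fromX m Q).commutes] at this
  | add p q hp hq => rw [map_add]; exact add _ _ hp hq
  | mul_X p i hp => rw [map_mul]; exact mul _ _ hp (hgen i)

lemma fromXY_induction {P : CoordRing m Q → Prop}
    (add : ∀ a b, P a → P b → P (a + b)) (mul : ∀ a b, P a → P b → P (a * b))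
    (const : ∀ c : ℂ, P (algebraMap ℂ _ c)) (hgen : ∀ k, P (gen m Q k))
    (a : (MvPolynomial (Fin n) ℂ)[X]) : P (fromXY m Q a) := by
  have hx : ∀ a, P (fromX m Q a) := fromX_induction add mul const fun i => hgen i.succ
  induction a using Polynomial.induction_on with
  | C c => exact hx c
  | add p q hp hq => rw [map_add]; exact add _ _ hp hq
  | monomial d a ih =>
    rw [pow_succ, ← mul_assoc, map_mul]
    exact mul _ _ ih (hgen 0)

@[elab_as_elim]
lemma CoordRing.induction {P : CoordRing m Q → Prop}
    (add : ∀ a b, P a → P b → P (a + b)) (mul : ∀ a b, P a → P b → P (a * b))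
    (const : ∀ c : ℂ, P (algebraMap ℂ _ c)) (hgen : ∀ k, P (gen m Q k)) (hz : P (zElem m Q))
    (b : CoordRing m Q) : P b := by
  have hp : ∀ p, P (fromXY m Q p) := fromXY_induction add mul const hgen
  obtain ⟨F, rfl⟩ := AdjoinRoot.mk_surjective b
  induction F using Polynomial.induction_on with
  | C p => exact hp p
  | add p q hp hq => rw [map_add]; exact add _ _ hp hq
  | monomial d a ih =>
    rw [pow_succ, ← mul_assoc, map_mul]
    exact mul _ _ ih hz

/-- The logarithmic form `χᵛ ↦ χ⁻ᵛ D(χᵛ)` of a derivation. -/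
def logForm (D : Derivation ℂ (CoordRing m Q) (CoordRing m Q)) : Exponent n →+ Laurent n where
  toFun u := ∑ k, (u k : ℤ) •
    (AddMonoidAlgebra.single (-basisExponent k) 1 * toLaurent m Q (D (gen m Q k)))
  map_zero' := Finset.sum_eq_zero fun _ _ => zero_smul ℤ _
  map_add' u v := by
    rw [← Finset.sum_add_distrib]
    exact Finset.sum_congr rfl fun k _ => add_smul (u k : ℤ) (v k : ℤ) _

lemma logForm_basisExponent (D : Derivation ℂ (CoordRing m Q) (CoordRing m Q)) (k : Fin (n + 1)) :
    logForm D (basisExponent k)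
      = AddMonoidAlgebra.single (-basisExponent k) 1 * toLaurent m Q (D (gen m Q k)) := by
  have h : ∀ j, (basisExponent k : Exponent n) j = (Pi.single k 1 : Fin (n + 1) → ℤ) j :=
    fun _ => rfl
  refine (Finset.sum_eq_single k ?_ fun hk => absurd (Finset.mem_univ k) hk).trans ?_
  · intro j _ hj
    rw [h, Pi.single_eq_of_ne hj, zero_smul]
  · rw [h, Pi.single_eq_same, one_smul]

/-- Both sides obey the Leibniz rule and agree on `y` and the `x_k`; agreement on `z` follows from
`x^m z = Q` by cancelling `x^m`. -/
lemma toLaurent_derivation (D : Derivation ℂ (CoordRing m Q) (CoordRing m Q))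
    (b : CoordRing m Q) : toLaurent m Q (D b) = logDeriv (logForm D) (toLaurent m Q b) := by
  have hmul : ∀ a b : CoordRing m Q,
      toLaurent m Q (D a) = logDeriv (logForm D) (toLaurent m Q a) →
      toLaurent m Q (D b) = logDeriv (logForm D) (toLaurent m Q b) →
      toLaurent m Q (D (a * b)) = logDeriv (logForm D) (toLaurent m Q (a * b)) := by
    intro a b ha hb
    rw [D.leibniz, map_mul, logDeriv_mul, ← ha, ← hb]
    simp
  have hadd : ∀ a b : CoordRing m Q,
      toLaurent m Q (D a) = logDeriv (logForm D) (toLaurent m Q a) →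
      toLaurent m Q (D b) = logDeriv (logForm D) (toLaurent m Q b) →
      toLaurent m Q (D (a + b)) = logDeriv (logForm D) (toLaurent m Q (a + b)) := by
    intro a b ha hb
    rw [map_add, map_add, map_add, logDeriv_add, ha, hb]
  have hconst : ∀ c : ℂ, toLaurent m Q (D (algebraMap ℂ _ c))
      = logDeriv (logForm D) (toLaurent m Q (algebraMap ℂ _ c)) := by
    intro c
    rw [D.map_algebraMap, map_zero, AlgHom.commutes]
    refine ((logDeriv_single (logForm D) 0 c).trans ?_).symm
    rw [map_zero, mul_zero]
  have hgen : ∀ k, toLaurent m Q (D (gen m Q k))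
      = logDeriv (logForm D) (toLaurent m Q (gen m Q k)) := by
    intro k
    rw [toLaurent_gen, logDeriv_single, logForm_basisExponent, ← mul_assoc,
      AddMonoidAlgebra.single_mul_single, add_neg_cancel, one_mul, ← AddMonoidAlgebra.one_def,
      one_mul]
  have hpoly := fromXY_induction (P := fun b => toLaurent m Q (D b)
      = logDeriv (logForm D) (toLaurent m Q b)) hadd hmul hconst hgen
  refine CoordRing.induction hadd hmul hconst hgen ?_ b
  have h1 := hpoly Q
  rw [← xMonomial_mul_zElem, D.leibniz, map_mul, logDeriv_mul, ← hpoly, map_add, smul_eq_mul,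
    smul_eq_mul, map_mul, map_mul, add_left_inj] at h1
  refine mul_left_cancel₀ ?_ h1
  rw [toLaurent_fromXY, polyToLaurent_xMonomial, Ne, AddMonoidAlgebra.single_eq_zero]
  exact one_ne_zero

lemma derivation_eq_zero_of_gen (hQ : Q.Monic) (hd : 0 < Q.natDegree)
    {D : Derivation ℂ (CoordRing m Q) (CoordRing m Q)} (h : ∀ k, D (gen m Q k) = 0) : D = 0 := by
  ext b
  refine toLaurent_injective hQ hd ?_
  have h0 : logForm D = 0 := by
    ext1 u
    change ∑ k, (u k : ℤ) • (AddMonoidAlgebra.single (-basisExponent k) (1 : ℂ) *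
      toLaurent m Q (D (gen m Q k))) = 0
    refine Finset.sum_eq_zero fun k _ => ?_
    rw [h, map_zero, mul_zero, smul_zero]
  rw [toLaurent_derivation, h0]
  simp [logDeriv]

lemma hasTop_logForm {D : Derivation ℂ (CoordRing m Q) (CoordRing m Q)} {E : Exponent n}
    {l : Fin (n + 1) → ℂ} (h : ∀ k, HasTop (logForm D (basisExponent k)) E (l k))
    (v : Exponent n) : HasTop (logForm D v) E (∑ k, ((v k : ℤ) : ℂ) * l k) := by
  have hv : ∀ w, (logForm D v).coeff w
      = ∑ k, ((v k : ℤ) : ℂ) * (logForm D (basisExponent k)).coeff w := by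
    intro w
    have h1 : logForm D v = ∑ k, (v k : ℤ) • logForm D (basisExponent k) := by
      simp only [logForm_basisExponent]
      rfl
    rw [h1, AddMonoidAlgebra.coeff_sum, Finsupp.finsetSum_apply]
    refine Finset.sum_congr rfl fun k _ => ?_
    rw [AddMonoidAlgebra.coeff_smul_apply, zsmul_eq_mul]
  refine ⟨(hv _).trans (Finset.sum_congr rfl fun k _ => by rw [(h k).1]), fun w hw => ?_⟩
  rw [hv]
  refine Finset.sum_eq_zero fun k _ => ?_
  rw [(h k).2 w hw, mul_zero]

/-- The leading part of a nonzero derivation: it has a degree `E`, and multiplies leading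
coefficients by a linear form in the leading exponent. -/
lemma exists_leading_part (hQ : Q.Monic) (hd : 0 < Q.natDegree)
    {D : Derivation ℂ (CoordRing m Q) (CoordRing m Q)} (hD : D ≠ 0) :
    ∃ (E : Exponent n) (l : Fin (n + 1) → ℂ), (∃ k, l k ≠ 0) ∧
      (∀ k, D (gen m Q k) = 0 → l k = 0) ∧
      ∀ b u c, HasTop (toLaurent m Q b) u c →
        HasTop (toLaurent m Q (D b)) (u + E) (c * ∑ k, (u k : ℤ) * l k) := by
  classical
  -- The degree `E` is the largest exponent occurring in any `logForm D (basisExponent k)`. Those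
  -- not reaching it get `l k = 0`.
  have hne : (Finset.univ.biUnion fun k =>
      (logForm D (basisExponent k)).coeff.support).Nonempty := by
    obtain ⟨k, hk⟩ : ∃ k, D (gen m Q k) ≠ 0 := by
      by_contra! h
      exact hD (derivation_eq_zero_of_gen hQ hd h)
    have h1 : (logForm D (basisExponent k)).coeff ≠ 0 := by
      intro h1
      refine hk (toLaurent_injective hQ hd ?_)
      rw [toLaurent_derivation, toLaurent_gen, logDeriv_single, AddMonoidAlgebra.coeff_eq_zero.1 h1,
        mul_zero, map_zero]
    obtain ⟨w, hw⟩ := Finsupp.support_nonempty_iff.2 h1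
    exact ⟨w, Finset.mem_biUnion.2 ⟨k, Finset.mem_univ _, hw⟩⟩
  set S := Finset.univ.biUnion fun k => (logForm D (basisExponent k)).coeff.support
  have htop : ∀ k, HasTop (logForm D (basisExponent k)) (S.max' hne)
      ((logForm D (basisExponent k)).coeff (S.max' hne)) := by
    refine fun k => ⟨rfl, fun v hv => by_contra fun h0 => ?_⟩
    refine absurd (S.le_max' v ?_) (not_le.2 hv)
    exact Finset.mem_biUnion.2 ⟨k, Finset.mem_univ _, Finsupp.mem_support_iff.2 h0⟩
  refine ⟨S.max' hne, fun k => (logForm D (basisExponent k)).coeff (S.max' hne), ?_, ?_, ?_⟩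
  · obtain ⟨k, -, hk⟩ := Finset.mem_biUnion.1 (S.max'_mem hne)
    exact ⟨k, Finsupp.mem_support_iff.1 hk⟩
  · intro k hk
    have h1 : logForm D (basisExponent k) = 0 := by
      rw [logForm_basisExponent, hk, map_zero, mul_zero]
    exact congrArg (fun h => h.coeff (S.max' hne)) h1
  · intro b u c hu
    rw [toLaurent_derivation]
    exact hu.logDeriv (hasTop_logForm htop)

end Derivations

/-! ### Locally nilpotent derivations: strings of leading exponents and kernels -/

section Nilpotent

variable {n : ℕ} {m : Fin n → ℕ} {Q : (MvPolynomial (Fin n) ℂ)[X]}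

/-- The linear form `l` evaluated at an exponent. -/
def linForm {n : ℕ} (l : Fin (n + 1) → ℂ) : Exponent n →+ ℂ where
  toFun u := ∑ k, ((u k : ℤ) : ℂ) * l k
  map_zero' := Finset.sum_eq_zero fun k _ => by
    rw [show ((0 : Exponent n) k : ℤ) = 0 from rfl, Int.cast_zero, zero_mul]
  map_add' u v := by
    rw [← Finset.sum_add_distrib]
    refine Finset.sum_congr rfl fun k _ => ?_
    rw [show ((u + v) k : ℤ) = (u k : ℤ) + (v k : ℤ) from rfl, Int.cast_add, add_mul]

lemma linForm_apply {n : ℕ} (l : Fin (n + 1) → ℂ) (u : Exponent n) :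
    linForm l u = (u 0 : ℤ) * l 0 + ∑ k : Fin n, ((u k.succ : ℤ) : ℂ) * l k.succ :=
  Fin.sum_univ_succ _

lemma linForm_basisExponent {n : ℕ} (l : Fin (n + 1) → ℂ) (k : Fin (n + 1)) :
    linForm l (basisExponent k) = l k := by
  have h : ∀ j, ((basisExponent k : Exponent n) j : ℤ) = (Pi.single k 1 : Fin (n + 1) → ℤ) j :=
    fun _ => rfl
  refine (Finset.sum_eq_single k ?_ fun hk => absurd (Finset.mem_univ k) hk).trans ?_
  · intro j _ hj
    rw [h, Pi.single_eq_of_ne hj, Int.cast_zero, zero_mul]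
  · rw [h, Pi.single_eq_same, Int.cast_one, one_mul]

/-- Iterating a derivation moves the leading exponent by its degree until the linear form
vanishes. -/
lemma exists_hasTop_iterate {D : Derivation ℂ (CoordRing m Q) (CoordRing m Q)}
    {E : Exponent n} {l : Fin (n + 1) → ℂ}
    (hE : ∀ b u c, HasTop (toLaurent m Q b) u c →
      HasTop (toLaurent m Q (D b)) (u + E) (c * linForm l u))
    {b : CoordRing m Q} {u : Exponent n} {c : ℂ} (hc : c ≠ 0) (hu : HasTop (toLaurent m Q b) u c) :
    ∀ N, (∀ j < N, linForm l (u + j • E) ≠ 0) →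
      ∃ c', c' ≠ 0 ∧ HasTop (toLaurent m Q (D^[N] b)) (u + N • E) c' := by
  intro N
  induction N with
  | zero => intro _; exact ⟨c, hc, by rwa [zero_smul, add_zero]⟩
  | succ N ih =>
    intro h
    obtain ⟨c', hc', h'⟩ := ih fun j hj => h j (hj.trans N.lt_succ_self)
    refine ⟨_, mul_ne_zero hc' (h N N.lt_succ_self), ?_⟩
    rw [Function.iterate_succ_apply', succ_nsmul, ← add_assoc]
    exact hE _ _ _ h'

lemma exists_linForm_eq_zero {D : Derivation ℂ (CoordRing m Q) (CoordRing m Q)}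
    {E : Exponent n} {l : Fin (n + 1) → ℂ}
    (hE : ∀ b u c, HasTop (toLaurent m Q b) u c →
      HasTop (toLaurent m Q (D b)) (u + E) (c * linForm l u))
    {b : CoordRing m Q} {u : Exponent n} {c : ℂ} (hc : c ≠ 0) (hu : HasTop (toLaurent m Q b) u c)
    {N : ℕ} (hN : D^[N] b = 0) : ∃ j < N, linForm l (u + j • E) = 0 := by
  by_contra! h
  obtain ⟨c', hc', h'⟩ := exists_hasTop_iterate hE hc hu N h
  exact h'.ne_zero hc' (by rw [hN, map_zero])

/-- The order of nilpotency of the leading part of a locally nilpotent derivation. -/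
lemma exists_order (hQ : Q.Monic) (hd : 0 < Q.natDegree)
    {D : Derivation ℂ (CoordRing m Q) (CoordRing m Q)} (hD : IsLocallyNilpotent D)
    {E : Exponent n} {l : Fin (n + 1) → ℂ}
    (hE : ∀ b u c, HasTop (toLaurent m Q b) u c →
      HasTop (toLaurent m Q (D b)) (u + E) (c * linForm l u))
    {b : CoordRing m Q} {u : Exponent n} {c : ℂ} (hc : c ≠ 0)
    (hu : HasTop (toLaurent m Q b) u c) :
    ∃ N : ℕ, linForm l u = -(N * linForm l E) ∧ ∀ j ≤ N,
      IsExponent m Q.natDegree ((u + j • E) 0) (fun i => (u + j • E) i.succ) := by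
  classical
  obtain ⟨K, hK⟩ := hD b
  have hex : ∃ j : ℕ, linForm l (u + j • E) = 0 := by
    obtain ⟨j, -, hj⟩ := exists_linForm_eq_zero hE hc hu hK
    exact ⟨j, hj⟩
  -- Minimality keeps the leading coefficient nonzero up to and including step `N`.
  refine ⟨Nat.find hex, ?_, fun j hj => ?_⟩
  · have := Nat.find_spec hex
    rw [map_add, map_nsmul, nsmul_eq_mul] at this
    exact eq_neg_of_add_eq_zero_left this
  · obtain ⟨c', hc', h'⟩ := exists_hasTop_iterate hE hc hu j
      fun i hi => Nat.find_min hex (hi.trans_le hj)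
    exact isExponent_of_hasTop hQ hd hc' h'

/-- The leading part of a locally nilpotent derivation lowers the `y`-degree. -/
lemma degree_zero_neg (hm : ∀ i, 1 < m i) (hQ : Q.Monic) (hr : 2 ≤ Q.natDegree)
    {D : Derivation ℂ (CoordRing m Q) (CoordRing m Q)} (hD : IsLocallyNilpotent D)
    {E : Exponent n} {l : Fin (n + 1) → ℂ} (hl : ∃ k, l k ≠ 0)
    (hE : ∀ b u c, HasTop (toLaurent m Q b) u c →
      HasTop (toLaurent m Q (D b)) (u + E) (c * linForm l u)) :
    (E 0 : ℤ) < 0 := by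
  have hd : 0 < Q.natDegree := by omega
  have hgen : ∀ k, HasTop (toLaurent m Q (gen m Q k)) (basisExponent k) 1 := by
    intro k
    rw [toLaurent_gen]
    exact hasTop_single _ _
  choose N hN hS using fun k => exists_order hQ hd hD hE one_ne_zero (hgen k)
  obtain ⟨c, hc, hSz⟩ := exists_order hQ hd hD hE one_ne_zero (hasTop_toLaurent_zElem m hQ)
  -- Otherwise `l` would be constant along strings, so it would vanish on all basis exponents.
  have hlE : linForm l E ≠ 0 := by
    intro h0
    obtain ⟨k, hk⟩ := hl
    have := hN k
    rw [linForm_basisExponent, h0, mul_zero, neg_zero] at this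
    exact hk this
  simp only [linForm_basisExponent] at hN
  have hS' : ∀ k, ∀ j ≤ N k, IsExponent m Q.natDegree
      ((Pi.single k 1 : Fin (n + 1) → ℤ) 0 + j * (E 0 : ℤ))
      (fun i => (Pi.single k 1 : Fin (n + 1) → ℤ) i.succ + j * (E i.succ : ℤ)) := by
    intro k j hj
    have := hS k j hj
    have h1 : ∀ i, ((basisExponent k + j • E : Exponent n) i : ℤ)
        = (Pi.single k 1 : Fin (n + 1) → ℤ) i + j * (E i : ℤ) := by
      intro i
      rw [← nsmul_eq_mul]
      rfl
    simp only [h1] at this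
    exact this
  refine degree_neg_of_orders (u := fun i => (E i.succ : ℤ)) (a := fun i => N i.succ) (b := N 0)
    (c := c) hm hr ?_ ?_ ?_ ?_ ?_
  -- Expand `l(E)` in coordinates, substitute `l k = -N k * l(E)`, and cancel `l(E)`; the next case
  -- does the same for `l` at the exponent of `z`.
  · have h1 := linForm_apply l E
    simp only [hN] at h1
    have h2 : ((N 0 * E 0 + ∑ k : Fin n, N k.succ * E k.succ : ℤ) : ℂ) * linForm l E
        = ((-1 : ℤ) : ℂ) * linForm l E := by
      have h3 : ∑ k : Fin n, ((E k.succ : ℤ) : ℂ) * -(N k.succ * linForm l E)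
          = -(∑ k : Fin n, (N k.succ : ℂ) * ((E k.succ : ℤ) : ℂ)) * linForm l E := by
        rw [← Finset.sum_neg_distrib, Finset.sum_mul]
        exact Finset.sum_congr rfl fun _ _ => by ring
      rw [h3] at h1
      push_cast
      linear_combination h1
    exact_mod_cast mul_right_cancel₀ hlE h2
  · rw [linForm_apply, zExponent_zero] at hc
    simp only [zExponent_succ, hN] at hc
    have h2 : ((c : ℤ) : ℂ) * linForm l E
        = ((Q.natDegree * N 0 - ∑ k : Fin n, m k * N k.succ : ℤ) : ℂ) * linForm l E := by
      have h3 : ∑ k : Fin n, ((-m k : ℤ) : ℂ) * -(N k.succ * linForm l E)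
          = (∑ k : Fin n, (m k : ℂ) * N k.succ) * linForm l E := by
        rw [Finset.sum_mul]
        exact Finset.sum_congr rfl fun _ _ => by push_cast; ring
      rw [h3] at hc
      push_cast at hc ⊢
      linear_combination hc
    exact_mod_cast mul_right_cancel₀ hlE h2
  · intro i j hj
    convert hS' i.succ j hj using 1
    · simp
    · funext k
      simp [Pi.single_apply]
  · convert hS' 0 _ le_rfl using 1
    · simp
    · funext k
      simp
  · convert hSz c le_rfl using 1
    · change _ = (zExponent m Q 0 : ℤ) + c • (E 0 : ℤ)
      rw [zExponent_zero, nsmul_eq_mul]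
    · funext k
      change _ = (zExponent m Q k.succ : ℤ) + c • (E k.succ : ℤ)
      rw [zExponent_succ, nsmul_eq_mul]

/-- Every locally nilpotent derivation of the coordinate ring kills `x₁, …, xₙ`. -/
theorem derivation_fromX_eq_zero (hm : ∀ i, 1 < m i) (hQ : Q.Monic) (hr : 2 ≤ Q.natDegree)
    {D : Derivation ℂ (CoordRing m Q) (CoordRing m Q)} (hD : IsLocallyNilpotent D)
    (a : MvPolynomial (Fin n) ℂ) : D (fromX m Q a) = 0 := by
  have hd : 0 < Q.natDegree := by omega
  by_cases hD0 : D = 0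
  · rw [hD0]; rfl
  obtain ⟨E, l, hl, -, hE⟩ := exists_leading_part hQ hd hD0
  have hE0 := degree_zero_neg hm hQ hr hD hl hE
  refine fromX_induction (P := fun b => D b = 0) ?_ ?_ (fun c => D.map_algebraMap c) ?_ a
  · intro a b ha hb
    rw [map_add, ha, hb, add_zero]
  · intro a b ha hb
    rw [D.leibniz, ha, hb, smul_zero, smul_zero, add_zero]
  · intro i
    have htop : HasTop (toLaurent m Q (gen m Q i.succ)) (basisExponent i.succ) 1 := by
      rw [toLaurent_gen]
      exact hasTop_single _ _
    refine (exists_hasTop_or_eq_zero hQ hd _).resolve_right ?_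
    rintro ⟨v, c, hc, hv, hS, -⟩
    have h0 := hS.nonneg
    -- The image of `x_i` has no exponents above one of negative `y`-degree, while a nonzero element
    -- has a leading exponent of nonnegative `y`-degree.
    refine hc (hv.1.symm.trans ((hE _ _ _ htop).2 v (Exponent.lt_of_zero_lt ?_)))
    change (Pi.single i.succ 1 : Fin (n + 1) → ℤ) 0 + E 0 < v 0
    rw [Pi.single_eq_of_ne (Fin.succ_ne_zero i).symm, zero_add]
    exact hE0.trans_le h0

lemma linForm_eq_of_fromX {D : Derivation ℂ (CoordRing m Q) (CoordRing m Q)}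
    (hx : ∀ a, D (fromX m Q a) = 0) {l : Fin (n + 1) → ℂ}
    (hl0 : ∀ k, D (gen m Q k) = 0 → l k = 0) (u : Exponent n) :
    linForm l u = (u 0 : ℤ) * l 0 := by
  rw [linForm_apply, Finset.sum_eq_zero, add_zero]
  intro k _
  rw [hl0 k.succ (hx _), mul_zero]

lemma apply_zero_ne_zero_of_fromX {D : Derivation ℂ (CoordRing m Q) (CoordRing m Q)}
    (hx : ∀ a, D (fromX m Q a) = 0) {l : Fin (n + 1) → ℂ} (hl : ∃ k, l k ≠ 0)
    (hl0 : ∀ k, D (gen m Q k) = 0 → l k = 0) : l 0 ≠ 0 := by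
  obtain ⟨k, hk⟩ := hl
  induction k using Fin.cases with
  | zero => exact hk
  | succ k => exact absurd (hl0 k.succ (hx _)) hk

/-- The kernel of a nonzero derivation killing `x₁, …, xₙ` consists of polynomials in these. -/
theorem mem_range_fromX_of_derivation_eq_zero (hQ : Q.Monic) (hd : 0 < Q.natDegree)
    {D : Derivation ℂ (CoordRing m Q) (CoordRing m Q)} (hD : D ≠ 0)
    (hx : ∀ a, D (fromX m Q a) = 0) {b : CoordRing m Q} (hb : D b = 0) :
    b ∈ (fromX m Q).range := by
  obtain ⟨E, l, hl, hl0, hE⟩ := exists_leading_part hQ hd hD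
  rcases exists_hasTop_or_eq_zero hQ hd b with rfl | ⟨u, c, hc, hu, -⟩
  · exact zero_mem _
  obtain ⟨j, hj, h⟩ := exists_linForm_eq_zero (N := 1) hE hc hu hb
  obtain rfl : j = 0 := by omega
  rw [zero_smul, add_zero, linForm_eq_of_fromX hx hl0, mul_eq_zero] at h
  exact mem_range_fromX_of_hasTop hQ hd hc hu
    (Int.cast_eq_zero.1 (h.resolve_right (apply_zero_ne_zero_of_fromX hx hl hl0)))

/-- The kernel of the square of a nonzero locally nilpotent derivation consists of polynomials in
`x₁, …, xₙ, y`. -/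
theorem mem_range_fromXY_of_derivation_sq_eq_zero (hm : ∀ i, 1 < m i) (hQ : Q.Monic)
    (hr : 2 ≤ Q.natDegree) {D : Derivation ℂ (CoordRing m Q) (CoordRing m Q)}
    (hD : IsLocallyNilpotent D) (hD0 : D ≠ 0) {b : CoordRing m Q} (hb : D (D b) = 0) :
    b ∈ (fromXY m Q).range := by
  have hd : 0 < Q.natDegree := by omega
  have hx := derivation_fromX_eq_zero hm hQ hr hD
  obtain ⟨E, l, hl, hl0, hE⟩ := exists_leading_part hQ hd hD0
  have hl1 := apply_zero_ne_zero_of_fromX hx hl hl0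
  have hy : HasTop (toLaurent m Q (gen m Q 0)) (basisExponent 0) 1 := by
    rw [toLaurent_gen]
    exact hasTop_single _ _
  -- As `l 0 ≠ 0`, the leading exponent of `D y` is exactly that of `y` shifted by `E`.
  have hE0 : -1 ≤ (E 0 : ℤ) := by
    have h1 := (isExponent_of_hasTop hQ hd (by
      rw [one_mul]
      exact (linForm_basisExponent l 0).trans_ne hl1) (hE _ _ _ hy)).nonneg
    have h2 : ((basisExponent 0 + E : Exponent n) 0 : ℤ) = 1 + (E 0 : ℤ) := rfl
    omega
  rcases exists_hasTop_or_eq_zero hQ hd b with rfl | ⟨u, c, hc, hu, -⟩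
  · exact zero_mem _
  obtain ⟨j, hj, h⟩ := exists_linForm_eq_zero (N := 2) hE hc hu hb
  rw [linForm_eq_of_fromX hx hl0, mul_eq_zero] at h
  have h1 : ((u + j • E : Exponent n) 0 : ℤ) = 0 := Int.cast_eq_zero.1 (h.resolve_right hl1)
  have h2 : ((u + j • E : Exponent n) 0 : ℤ) = (u 0 : ℤ) + j * (E 0 : ℤ) := by
    rw [← nsmul_eq_mul]
    rfl
  have hlt : (u 0 : ℤ) < Q.natDegree := by
    have hj' : j = 0 ∨ j = 1 := by omega
    rcases hj' with rfl | rfl <;> push_cast at h2 <;> omega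
  obtain ⟨p, -, hp⟩ := exists_fromXY_of_hasTop hQ hd hc hu hlt
  exact ⟨p, hp⟩

end Nilpotent

/-! ### Actions and derivations -/

namespace AdditiveAction

variable {k B : Type*} [CommRing k] [CommRing B] [Algebra k B]

lemma coeff_zero_comorphism (μ : AdditiveAction k B) (b : B) : (μ.comorphism b).coeff 0 = b := by
  rw [coeff_zero_eq_eval_zero, μ.zero_act]

/-- The infinitesimal generator of an action. -/
def toDerivation (μ : AdditiveAction k B) : Derivation k B B :=
  Derivation.mk' (((lcoeff B 1).restrictScalars k).comp μ.comorphism.toLinearMap) fun a b => by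
    change (μ.comorphism (a * b)).coeff 1
      = a * (μ.comorphism b).coeff 1 + b * (μ.comorphism a).coeff 1
    rw [map_mul, mul_coeff_one, μ.coeff_zero_comorphism, μ.coeff_zero_comorphism]
    ring

lemma toDerivation_apply (μ : AdditiveAction k B) (b : B) :
    μ.toDerivation b = (μ.comorphism b).coeff 1 := rfl

lemma coeff_one_aeval_X_add_C_X (p : B[X]) :
    (aeval (X + C X : B[X][X]) p).coeff 1 = derivative p := by
  induction p using Polynomial.induction_on' with
  | add p q hp hq => rw [map_add, coeff_add, hp, hq, map_add]
  | monomial d a =>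
    rw [aeval_monomial]
    change (C (C a) * (X + C X) ^ d : B[X][X]).coeff 1 = _
    rw [coeff_C_mul, coeff_X_add_C_pow, Nat.choose_one_right, derivative_monomial,
      ← C_mul_X_pow_eq_monomial, C_mul, C_eq_natCast]
    ring

/-- Compare the terms linear in the outer variable in the additivity axiom: the linear Taylor term
is the derivative. Iterating the generator thus lowers the degree of the comorphism. -/
lemma comorphism_toDerivation (μ : AdditiveAction k B) (b : B) :
    μ.comorphism (μ.toDerivation b) = derivative (μ.comorphism b) := by
  rw [← coeff_one_aeval_X_add_C_X, ← μ.add_act, coeff_map]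
  rfl

lemma isLocallyNilpotent_toDerivation (μ : AdditiveAction k B) :
    IsLocallyNilpotent μ.toDerivation := by
  intro b
  have h : ∀ N, μ.comorphism (μ.toDerivation^[N] b) = derivative^[N] (μ.comorphism b) := by
    intro N
    induction N with
    | zero => rfl
    | succ N ih =>
      rw [Function.iterate_succ_apply', comorphism_toDerivation, ih, Function.iterate_succ_apply']
  refine ⟨(μ.comorphism b).natDegree + 1, ?_⟩
  rw [← μ.zero_act (μ.toDerivation^[_] b), h,
    iterate_derivative_eq_zero (Nat.lt_succ_self _), eval_zero]

lemma isInvariant_of_toDerivation_eq_zero [IsAddTorsionFree B] (μ : AdditiveAction k B)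
    {b : B} (hb : μ.toDerivation b = 0) : μ.IsInvariant b := by
  have h := μ.comorphism_toDerivation b
  rw [hb, map_zero] at h
  have h1 := eq_C_of_natDegree_eq_zero (derivative_eq_zero.1 h.symm)
  rwa [μ.coeff_zero_comorphism] at h1

end AdditiveAction

/-! ### A nontrivial action fixing the `x_k` -/

section Triangular

variable {n : ℕ} {m : Fin n → ℕ} {Q : (MvPolynomial (Fin n) ℂ)[X]}

/-- The substitution `y ↦ y + x^[m] t` on polynomials. -/
def shift (m : Fin n → ℕ) (Q : (MvPolynomial (Fin n) ℂ)[X]) :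
    (MvPolynomial (Fin n) ℂ)[X] →ₐ[ℂ] (CoordRing m Q)[X] :=
  Polynomial.eval₂AlgHom (CAlgHom.comp (fromX m Q))
    (C (fromXY m Q X) + C (fromX m Q (xMonomial m)) * X) fun _ => Commute.all _ _

lemma shift_C (a : MvPolynomial (Fin n) ℂ) : shift m Q (C a) = C (fromX m Q a) :=
  eval₂_C _ _

lemma shift_X : shift m Q X = C (fromXY m Q X) + C (fromX m Q (xMonomial m)) * X :=
  eval₂_X _ _

/-- The quotient for `p = Q` supplies the increment of `z`, so that the substitution extends to the
coordinate ring. -/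
lemma dvd_shift_sub (p : (MvPolynomial (Fin n) ℂ)[X]) :
    C (fromX m Q (xMonomial m)) * X ∣ shift m Q p - C (fromXY m Q p) := by
  induction p using Polynomial.induction_on with
  | C a =>
    rw [shift_C]
    exact (sub_self (C (fromX m Q a))).symm ▸ dvd_zero _
  | add p q hp hq =>
    rw [map_add, map_add, C_add, add_sub_add_comm]
    exact dvd_add hp hq
  | monomial d a ih =>
    rw [pow_succ, ← mul_assoc, map_mul (shift m Q), map_mul (fromXY m Q), C_mul, shift_X]
    have h : shift m Q (C a * X ^ d) *
          (C (fromXY m Q X) + C (fromX m Q (xMonomial m)) * X)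
        - C (fromXY m Q (C a * X ^ d)) * C (fromXY m Q X)
        = (shift m Q (C a * X ^ d) - C (fromXY m Q (C a * X ^ d))) * C (fromXY m Q X)
          + C (fromX m Q (xMonomial m)) * X * shift m Q (C a * X ^ d) := by ring
    rw [h]
    exact dvd_add (ih.mul_right _) (dvd_mul_right _ _)

/-- The action `y ↦ y + x^[m] t` fixing `x₁, …, xₙ`. -/
lemma exists_triangular_action (hQ : Q.Monic) (hd : 0 < Q.natDegree) :
    ∃ μ : AdditiveAction ℂ (CoordRing m Q),
      (∀ a, μ.comorphism (fromX m Q a) = C (fromX m Q a)) ∧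
      μ.comorphism (fromXY m Q X) = C (fromXY m Q X) + C (fromX m Q (xMonomial m)) * X := by
  have := CoordRing.isDomain (m := m) hQ hd
  obtain ⟨H, hH⟩ := dvd_shift_sub (m := m) (Q := Q) Q
  have heq : (equation m Q).eval₂
      (shift m Q : (MvPolynomial (Fin n) ℂ)[X] →+* (CoordRing m Q)[X])
      (C (zElem m Q) + X * H) = 0 := by
    have hz := congrArg (C : CoordRing m Q → (CoordRing m Q)[X]) (xMonomial_mul_zElem m Q)
    rw [C_mul] at hz
    change C (fromX m Q (xMonomial m)) * C (zElem m Q) = _ at hz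
    rw [eval₂_equation_eq, RingHom.coe_coe, shift_C]
    linear_combination hz - hH
  let φ : CoordRing m Q →ₐ[ℂ] (CoordRing m Q)[X] := AdjoinRoot.liftAlgHom _ (shift m Q) _ heq
  have hφ : ∀ p, φ (fromXY m Q p) = shift m Q p := fun p => AdjoinRoot.liftAlgHom_of _ _ _ _ _
  have hφx : ∀ a, φ (fromX m Q a) = C (fromX m Q a) := fun a => (hφ _).trans (shift_C a)
  have hφy : φ (fromXY m Q X) = C (fromXY m Q X) + C (fromX m Q (xMonomial m)) * X :=
    (hφ X).trans shift_X
  have hφz : φ (zElem m Q) = C (zElem m Q) + X * H := AdjoinRoot.liftAlgHom_root _ _ _ _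
  have hφc : ∀ c : ℂ, φ (algebraMap ℂ _ c) = C (algebraMap ℂ _ c) := fun c => φ.commutes c
  let P : CoordRing m Q → Prop := fun b =>
    (φ b).map (φ : CoordRing m Q →+* (CoordRing m Q)[X])
      = aeval (X + C X : (CoordRing m Q)[X][X]) (φ b)
  have Padd : ∀ a b, P a → P b → P (a + b) := by
    intro a b ha hb
    change Polynomial.map _ (φ (a + b)) = aeval _ (φ (a + b))
    rw [map_add φ, Polynomial.map_add, map_add, ha, hb]
  have Pmul : ∀ a b, P a → P b → P (a * b) := by
    intro a b ha hb
    change Polynomial.map _ (φ (a * b)) = aeval _ (φ (a * b))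
    rw [map_mul φ, Polynomial.map_mul, map_mul, ha, hb]
  have PC : ∀ b, φ b = C b → P b := by
    intro b hb
    change Polynomial.map _ (φ b) = aeval _ (φ b)
    rw [hb, map_C, aeval_C, RingHom.coe_coe, hb]
    rfl
  have Pgen : ∀ k, P (gen m Q k) := by
    intro k
    refine Fin.cases ?_ (fun i => PC _ (hφx _)) k
    change Polynomial.map _ (φ (fromXY m Q X)) = aeval _ (φ (fromXY m Q X))
    rw [hφy, Polynomial.map_add, Polynomial.map_mul, map_C, map_C, map_X, map_add, map_mul,
      aeval_C, aeval_C, aeval_X, RingHom.coe_coe, hφy, hφx]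
    change C (C (fromXY m Q X) + C (fromX m Q (xMonomial m)) * X) + C (C (fromX m Q (xMonomial m))) * X
      = C (C (fromXY m Q X)) + C (C (fromX m Q (xMonomial m))) * (X + C X)
    rw [C_add, C_mul]
    ring
  have Pxy : ∀ p, P (fromXY m Q p) := fromXY_induction Padd Pmul (fun c => PC _ (hφc c)) Pgen
  have Pz : P (zElem m Q) := by
    -- Additivity on `z` is deduced from additivity on `Q = x^m z` by cancelling `x^m` in a domain.
    have hw : (aeval (X + C X : (CoordRing m Q)[X][X])) (φ (fromX m Q (xMonomial m))) ≠ 0 := by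
      rw [hφx, aeval_C]
      exact C_ne_zero.2 (C_ne_zero.2 (fromX_xMonomial_ne_zero m Q))
    refine mul_left_cancel₀ hw ?_
    have h1 := Pxy Q
    rw [← xMonomial_mul_zElem] at h1
    change Polynomial.map _ (φ _) = aeval _ (φ _) at h1
    rw [map_mul φ, Polynomial.map_mul, map_mul, Pxy] at h1
    exact h1
  refine ⟨⟨φ, fun b => ?_, fun b => ?_⟩, hφx, hφy⟩
  · induction b using CoordRing.induction with
    | add a b ha hb => rw [map_add, eval_add, ha, hb]
    | mul a b ha hb => rw [map_mul, eval_mul, ha, hb]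
    | const c => rw [hφc, eval_C]
    | hgen k =>
      refine Fin.cases ?_ (fun i => ?_) k
      · change (φ (fromXY m Q X)).eval 0 = fromXY m Q X
        rw [hφy, eval_add, eval_mul, eval_C, eval_X, mul_zero, add_zero]
      · change (φ (fromX m Q _)).eval 0 = fromX m Q _
        rw [hφx, eval_C]
    | hz => rw [hφz, eval_add, eval_mul, eval_C, eval_X, zero_mul, add_zero]
  · exact CoordRing.induction (P := P) Padd Pmul (fun c => PC _ (hφc c)) Pgen Pz b

end Triangular

/-- The Makar-Limanov invariant of the coordinate ring. -/
theorem makarLimanov_eq {n : ℕ} {m : Fin n → ℕ} (hm : ∀ i, 1 < m i)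
    {Q : (MvPolynomial (Fin n) ℂ)[X]} (hQ : Q.Monic) (hr : 2 ≤ Q.natDegree) :
    makarLimanov ℂ (CoordRing m Q) = (fromX m Q).range := by
  have hd : 0 < Q.natDegree := by omega
  have : IsAddTorsionFree (CoordRing m Q) := IsAddTorsionFree.of_module_rat _
  refine le_antisymm (fun b hb => ?_) ?_
  · obtain ⟨μ, hx, hy⟩ := exists_triangular_action (m := m) hQ hd
    -- The generator sends `y` to `x^m ≠ 0`, so it is nonzero and its kernel is covered.
    refine mem_range_fromX_of_derivation_eq_zero hQ hd (D := μ.toDerivation) ?_ ?_ ?_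
    · intro h0
      have h1 : μ.toDerivation (fromXY m Q X) = 0 := by rw [h0]; rfl
      rw [μ.toDerivation_apply, hy, coeff_add, coeff_C_mul, coeff_X_one, mul_one,
        coeff_C_of_ne_zero one_ne_zero, zero_add] at h1
      exact fromX_xMonomial_ne_zero m Q h1
    · intro a
      rw [μ.toDerivation_apply, hx, coeff_C_of_ne_zero one_ne_zero]
    · have h1 : μ.comorphism b = C b := hb μ
      rw [μ.toDerivation_apply, h1, coeff_C_of_ne_zero one_ne_zero]
  · rintro _ ⟨a, rfl⟩ μ
    exact μ.isInvariant_of_toDerivation_eq_zero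
      (derivation_fromX_eq_zero hm hQ hr μ.isLocallyNilpotent_toDerivation a)

end Danielewski

end

theorem mainTheorem1 (n : ℕ) (m : Fin n → ℕ) (hm : ∀ i, 1 < m i)
    (Q : Polynomial (MvPolynomial (Fin n) ℂ)) (hQ : Q.Monic) (hr : 2 ≤ Q.natDegree) :
    Function.Injective (Danielewski.fromX m Q) ∧
    Danielewski.makarLimanov ℂ (Danielewski.CoordRing m Q) = (Danielewski.fromX m Q).range ∧
    ∀ D : Derivation ℂ (Danielewski.CoordRing m Q) (Danielewski.CoordRing m Q),
      Danielewski.IsLocallyNilpotent D → D ≠ 0 →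
        ∀ b, D (D b) = 0 → b ∈ (Danielewski.fromXY m Q).range :=
  ⟨Danielewski.fromX_injective m Q, Danielewski.makarLimanov_eq hm hQ hr, fun _ hD hD0 _ hb =>
    Danielewski.mem_range_fromXY_of_derivation_sq_eq_zero hm hQ hr hD hD0 hb⟩
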